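/- **Theorem 1.1 (The third order Dieudonné Lemma).** Let $\mathbb D$ be the open unit disk, $\overline{\mathbb D}$ its closure, and $\mathcal H_0$ the set of all analytic maps $f:\mathbb D\to\mathbb D$ with $f(0)=0$. For $a\in\mathbb D$ put $T_a(z)=\dfrac{z+a}{1+\overline a z}$. Let $z_0,w_0\in\mathbb D$ with $|w_0|=s<r=|z_0|$, let $\lambda,\mu\in\overline{\mathbb D}$, and set $$w_1=\frac{w_0}{z_0}+\frac{r^2-s^2}{z_0(1-r^2)}\lambda,\qquad w_2=\frac{2(r^2-s^2)\lambda(1-\overline{w_0}\lambda)}{z_0^2(1-r^2)^2}+\frac{2(r^2-s^2)(1-|\lambda|^2)}{z_0(1-r^2)^2}\mu,$$ $$c=\frac{6(r^2-s^2)}{z_0^3(1-r^2)^3}\Big(\mathcal B+z_0\mu(1-|\lambda|^2)(1+r^2-2\overline{w_0}\lambda-z_0\overline\lambda\mu)\Big),\qquad \mathcal B=\overline{w_0}^2\lambda^3-\overline{w_0}(1+r^2)\lambda^2+r^2\lambda,$$ $$\rho=\frac{6(r^2-s^2)}{r(1-r^2)^3}(1-|\lambda|^2)(1-|\mu|^2),\qquad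 u_0=\frac{w_0}{z_0},\quad v_0=\frac{r^2\lambda}{z_0^2},\quad \tau=\frac{\overline{z_0}\mu}{z_0},\quad \eta=\frac{r^2\mu}{z_0^2}.$$ Let $\mathcal A$ be the set of all $f\in\mathcal H_0$ with $f(z_0)=w_0$, $f'(z_0)=w_1$ and $f''(z_0)=w_2$. 1. If $|\lambda|=1$, then every $f\in\mathcal A$ satisfies $f'''(z_0)=c$ and $f(z)=z\,T_{u_0}(v_0T_{-z_0}(z))$ for all $z\in\mathbb D$. 2. If $|\lambda|<1$ and $|\mu|=1$, then every $f\in\mathcal A$ satisfies $f'''(z_0)=c$ and $f(z)=z\,T_{u_0}\big(T_{-z_0}(z)\,T_{v_0}(\tau T_{-z_0}(z))\big)$ for all $z\in\mathbb D$. 3. If $|\lambda|<1$ and $|\mu|<1$, then $\{f'''(z_0): f\in\mathcal A\}=\{\zeta\in\mathbb C:|\zeta-c|\le\rho\}$. Furthermore, the functions $f\in\mathcal A$ with $|f'''(z_0)-c|=\rho$ are exactly the functions $$f(z)=z\,T_{u_0}\Big(T_{-z_0}(z)\,T_{v_0}\big(T_{-z_0}(z)\,T_{\eta}(e^{i\theta}T_{-z_0}(z))\big)\Big)\quad(z\in\mathbb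 D),\qquad \theta\in\mathbb R.$$ -/

import Mathlib

namespace ThirdDieudonne

open scoped ComplexConjugate

/-- The class `H₀` of analytic self-maps `f` of the open unit disk with `f 0 = 0`. A map of the disk
is represented by a function `ℂ → ℂ`, of which only the values on the open unit disk matter. -/
def H0 : Set (ℂ → ℂ) :=
  {f | DifferentiableOn ℂ f (Metric.ball 0 1) ∧
    Set.MapsTo f (Metric.ball 0 1) (Metric.ball 0 1) ∧ f 0 = 0}

/-- The Moebius transformation `T_a(z) = (z + a) / (1 + conj a * z)`. -/
noncomputable def T (a z : ℂ) : ℂ := (z + a) / (1 + conj a * z)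

/-- The prescribed first derivative `w₁`, parametrized by `lam`. -/
noncomputable def w1 (z₀ w₀ lam : ℂ) : ℂ :=
  w₀ / z₀ + ((‖z₀‖ : ℂ) ^ 2 - (‖w₀‖ : ℂ) ^ 2) / (z₀ * (1 - (‖z₀‖ : ℂ) ^ 2)) * lam

/-- The prescribed second derivative `w₂`, parametrized by `lam` and `mu`. -/
noncomputable def w2 (z₀ w₀ lam mu : ℂ) : ℂ :=
  2 * ((‖z₀‖ : ℂ) ^ 2 - (‖w₀‖ : ℂ) ^ 2) * lam * (1 - conj w₀ * lam) /
      (z₀ ^ 2 * (1 - (‖z₀‖ : ℂ) ^ 2) ^ 2) +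
    2 * ((‖z₀‖ : ℂ) ^ 2 - (‖w₀‖ : ℂ) ^ 2) * (1 - (‖lam‖ : ℂ) ^ 2) /
      (z₀ * (1 - (‖z₀‖ : ℂ) ^ 2) ^ 2) * mu

/-- The functions `f ∈ H₀` with `f(z₀) = w₀`, `f'(z₀) = w₁`, `f''(z₀) = w₂`. -/
def admissible (z₀ w₀ lam mu : ℂ) : Set (ℂ → ℂ) :=
  {f | f ∈ H0 ∧ f z₀ = w₀ ∧ deriv f z₀ = w1 z₀ w₀ lam ∧
    iteratedDeriv 2 f z₀ = w2 z₀ w₀ lam mu}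

/-- The quantity `B = conj w₀ ^ 2 lam ^ 3 - conj w₀ (1 + r ^ 2) lam ^ 2 + r ^ 2 lam`. -/
noncomputable def B (z₀ w₀ lam : ℂ) : ℂ :=
  conj w₀ ^ 2 * lam ^ 3 - conj w₀ * (1 + (‖z₀‖ : ℂ) ^ 2) * lam ^ 2 + (‖z₀‖ : ℂ) ^ 2 * lam

/-- The centre `c` of the disk of values of `f'''(z₀)`. -/
noncomputable def c (z₀ w₀ lam mu : ℂ) : ℂ :=
  6 * ((‖z₀‖ : ℂ) ^ 2 - (‖w₀‖ : ℂ) ^ 2) / (z₀ ^ 3 * (1 - (‖z₀‖ : ℂ) ^ 2) ^ 3) *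
    (B z₀ w₀ lam + z₀ * mu * (1 - (‖lam‖ : ℂ) ^ 2) *
      (1 + (‖z₀‖ : ℂ) ^ 2 - 2 * conj w₀ * lam - z₀ * conj lam * mu))

/-- The radius of the disk of values of `f'''(z₀)`. -/
noncomputable def rho (z₀ w₀ lam mu : ℂ) : ℝ :=
  6 * (‖z₀‖ ^ 2 - ‖w₀‖ ^ 2) / (‖z₀‖ * (1 - ‖z₀‖ ^ 2) ^ 3) * (1 - ‖lam‖ ^ 2) * (1 - ‖mu‖ ^ 2)

noncomputable def u0 (z₀ w₀ : ℂ) : ℂ := w₀ / z₀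

noncomputable def v0 (z₀ lam : ℂ) : ℂ := (‖z₀‖ : ℂ) ^ 2 * lam / z₀ ^ 2

noncomputable def tau (z₀ mu : ℂ) : ℂ := conj z₀ * mu / z₀

noncomputable def eta (z₀ mu : ℂ) : ℂ := (‖z₀‖ : ℂ) ^ 2 * mu / z₀ ^ 2

end ThirdDieudonne

namespace ThirdDieudonne

open scoped ComplexConjugate
open Metric Set

/-! The proof is the Schur algorithm run three times at the single point `z₀`. By the Schwarz lemma
`f = z g` with `g` in the Schur class, and `g z₀ = u₀` lies inside the disk. Schwarz-Pick in
divisibility form (`exists_schurStep`) then peels off one Schur parameter at a time: `g = T u₀ (T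
(-z₀) h)`, `h = T v₀ (T (-z₀) k)`, `k = T η (T (-z₀) l)`.

Differentiating at `z₀` shows that the data are Schur parameters in disguise: `f' = w₁` means `h z₀
= v₀`, and, when `|lam| < 1`, `f'' = w₂` means `k z₀ = η`. Since `|v₀| = |lam|` and `|η| = |mu|`, a
unimodular parameter makes `h` or `k` constant by the maximum principle, which stops the algorithm
and determines `f`. If both are interior, `l` is an arbitrary Schur function and `f''' = c + κ
l(z₀)` with `|κ| = rho` (`mem_admissible_of_three_factors`). Constant `l` already fill the closed
disk, and a boundary value forces `|l z₀| = 1`, so `l` is a unimodular constant. -/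

/-- The closed Schur class: holomorphic maps of the unit disk into the closed unit disk. -/
def Schur : Set (ℂ → ℂ) :=
  {f | DifferentiableOn ℂ f (ball 0 1) ∧ ∀ z ∈ ball (0 : ℂ) 1, ‖f z‖ ≤ 1}

/-! ### Möbius maps of the disk -/

theorem one_add_conj_mul_ne_zero {a z : ℂ} (ha : ‖a‖ < 1) (hz : ‖z‖ ≤ 1) :
    1 + conj a * z ≠ 0 := by
  intro h
  have h1 : ‖conj a * z‖ = 1 := by
    rw [show conj a * z = -1 by linear_combination h]; simp
  rw [norm_mul, RCLike.norm_conj] at h1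
  nlinarith [norm_nonneg a, norm_nonneg z]

/-- The sign of the right-hand side is what makes `T a` preserve the open and the closed disk. -/
theorem normSq_T_identity (a z : ℂ) :
    ‖1 + conj a * z‖ ^ 2 - ‖z + a‖ ^ 2 = (1 - ‖a‖ ^ 2) * (1 - ‖z‖ ^ 2) := by
  have h : ((‖1 + conj a * z‖ ^ 2 - ‖z + a‖ ^ 2 : ℝ) : ℂ)
      = ((1 - ‖a‖ ^ 2) * (1 - ‖z‖ ^ 2) : ℝ) := by
    push_cast
    simp only [← Complex.mul_conj', map_add, map_mul, map_one, Complex.conj_conj]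
    ring
  exact_mod_cast h

theorem norm_T_le_one {a z : ℂ} (ha : ‖a‖ < 1) (hz : ‖z‖ ≤ 1) : ‖T a z‖ ≤ 1 := by
  have h0 := norm_pos_iff.2 (one_add_conj_mul_ne_zero ha hz)
  rw [T, norm_div, div_le_one h0]
  refine le_of_sq_le_sq ?_ h0.le
  have := normSq_T_identity a z
  have : 0 ≤ (1 - ‖a‖ ^ 2) * (1 - ‖z‖ ^ 2) :=
    mul_nonneg (by nlinarith [norm_nonneg a]) (by nlinarith [norm_nonneg z])
  linarith

theorem norm_T_lt_one {a z : ℂ} (ha : ‖a‖ < 1) (hz : ‖z‖ < 1) : ‖T a z‖ < 1 := by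
  have h0 := norm_pos_iff.2 (one_add_conj_mul_ne_zero ha hz.le)
  rw [T, norm_div, div_lt_one h0]
  refine lt_of_pow_lt_pow_left₀ 2 h0.le ?_
  have := normSq_T_identity a z
  have : 0 < (1 - ‖a‖ ^ 2) * (1 - ‖z‖ ^ 2) :=
    mul_pos (by nlinarith [norm_nonneg a]) (by nlinarith [norm_nonneg z])
  linarith

theorem T_T_neg {a z : ℂ} (ha : ‖a‖ < 1) (hz : ‖z‖ ≤ 1) : T a (T (-a) z) = z := by
  have h1 : 1 - conj a * z ≠ 0 := by
    simpa [sub_eq_add_neg] using one_add_conj_mul_ne_zero (a := -a) (by simpa using ha) hz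
  have h2 : 1 - conj a * a ≠ 0 := by
    simpa [sub_eq_add_neg] using one_add_conj_mul_ne_zero (a := -a) (by simpa using ha) ha.le
  have h3 : T (-a) z = (z - a) / (1 - conj a * z) := by
    simp [T, sub_eq_add_neg]
  have h4 : 1 + conj a * ((z - a) / (1 - conj a * z)) = (1 - conj a * a) / (1 - conj a * z) := by
    field_simp; ring
  have h5 : (z - a) / (1 - conj a * z) + a = z * (1 - conj a * a) / (1 - conj a * z) := by
    rw [div_add' _ _ _ h1]; congr 1; ring
  rw [h3, T, h4, h5, div_div_div_cancel_right₀ h1, mul_div_cancel_right₀ _ h2]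

theorem T_zero_right (a : ℂ) : T a 0 = a := by simp [T]

theorem T_neg_self (a : ℂ) : T (-a) a = 0 := by simp [T]

theorem differentiableOn_T {a : ℂ} (ha : ‖a‖ < 1) :
    DifferentiableOn ℂ (T a) (closedBall 0 1) := by
  unfold T
  refine DifferentiableOn.div (by fun_prop) (by fun_prop) fun z hz ↦
    one_add_conj_mul_ne_zero ha (by simpa using hz)

theorem mapsTo_T {a : ℂ} (ha : ‖a‖ < 1) : MapsTo (T a) (ball 0 1) (ball 0 1) := fun z hz ↦ by
  simpa using norm_T_lt_one ha (by simpa using hz)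

/-! ### The Schur class and division by Blaschke factors -/

theorem const_mem_Schur {a : ℂ} (ha : ‖a‖ ≤ 1) : (fun _ ↦ a) ∈ Schur :=
  ⟨differentiableOn_const _, fun _ _ ↦ ha⟩

theorem comp_T_mem_Schur {F : ℂ → ℂ} (hF : F ∈ Schur) {a : ℂ} (ha : ‖a‖ < 1) :
    (fun z ↦ F (T a z)) ∈ Schur :=
  ⟨hF.1.comp ((differentiableOn_T ha).mono ball_subset_closedBall) (mapsTo_T ha),
    fun _ hz ↦ hF.2 _ (mapsTo_T ha hz)⟩

theorem T_comp_mem_Schur {F : ℂ → ℂ} (hF : F ∈ Schur) {a : ℂ} (ha : ‖a‖ < 1) :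
    (fun z ↦ T a (F z)) ∈ Schur :=
  ⟨(differentiableOn_T ha).comp hF.1 fun z hz ↦ by simpa using hF.2 z hz,
    fun z hz ↦ norm_T_le_one ha (hF.2 z hz)⟩

theorem mul_mem_Schur {F G : ℂ → ℂ} (hF : F ∈ Schur) (hG : G ∈ Schur) :
    (fun z ↦ F z * G z) ∈ Schur :=
  ⟨hF.1.mul hG.1, fun z hz ↦ by
    rw [norm_mul]; exact mul_le_one₀ (hF.2 z hz) (norm_nonneg _) (hG.2 z hz)⟩

theorem T_mem_Schur {a : ℂ} (ha : ‖a‖ < 1) : T a ∈ Schur :=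
  ⟨(differentiableOn_T ha).mono ball_subset_closedBall, fun z hz ↦
    (norm_T_lt_one ha (by simpa using hz)).le⟩

/-- The inverse Schur step. -/
theorem schurStep_mem_Schur {h : ℂ → ℂ} (hh : h ∈ Schur) {z₀ u : ℂ} (hz₀ : ‖z₀‖ < 1)
    (hu : ‖u‖ < 1) : (fun z ↦ T u (T (-z₀) z * h z)) ∈ Schur :=
  T_comp_mem_Schur (mul_mem_Schur (T_mem_Schur (by simpa using hz₀)) hh) hu

theorem norm_schurStep_lt_one {h : ℂ → ℂ} (hh : h ∈ Schur) {z₀ u z : ℂ} (hz₀ : ‖z₀‖ < 1)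
    (hu : ‖u‖ < 1) (hz : ‖z‖ < 1) : ‖T u (T (-z₀) z * h z)‖ < 1 := by
  refine norm_T_lt_one hu ?_
  rw [norm_mul]
  have h1 := norm_T_lt_one (a := -z₀) (by simpa using hz₀) hz
  have h2 := hh.2 z (by simpa using hz)
  nlinarith [norm_nonneg (T (-z₀) z), norm_nonneg (h z)]

/-- A map of the Schur class with a zero at `0` is divisible by the identity. -/
theorem exists_eq_id_mul {F : ℂ → ℂ} (hF : F ∈ Schur) (h0 : F 0 = 0) :
    ∃ k ∈ Schur, ∀ z, F z = z * k z := by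
  -- `dslope` is `F z / z` with the value `F'(0)` filled in at the origin; the Schwarz lemma bounds
  -- it by `1`.
  refine ⟨dslope F 0, ⟨?_, fun z hz ↦ ?_⟩, fun z ↦ ?_⟩
  · exact (Complex.differentiableOn_dslope (ball_mem_nhds 0 one_pos)).2 hF.1
  · have hm : MapsTo F (ball 0 1) (closedBall (F 0) 1) := fun z hz ↦ by
      simpa [h0] using hF.2 z hz
    simpa using Complex.norm_dslope_le_div_of_mapsTo_ball hF.1 hm hz
  · have := sub_smul_dslope F 0 z
    simpa [h0] using this.symm

/-- A map of the Schur class with a zero at `z₀` is divisible by `T (-z₀)`. -/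
theorem exists_eq_T_neg_mul {F : ℂ → ℂ} (hF : F ∈ Schur) {z₀ : ℂ} (hz₀ : ‖z₀‖ < 1)
    (h0 : F z₀ = 0) : ∃ k ∈ Schur, ∀ z ∈ ball (0 : ℂ) 1, F z = T (-z₀) z * k z := by
  -- Precomposing with `T z₀` moves the zero to the origin; `T (-z₀)` moves it back.
  obtain ⟨K, hK, hFK⟩ := exists_eq_id_mul (comp_T_mem_Schur hF hz₀) (by simpa [T_zero_right])
  refine ⟨fun z ↦ K (T (-z₀) z), comp_T_mem_Schur hK (by simpa using hz₀), fun z hz ↦ ?_⟩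
  rw [← hFK, T_T_neg hz₀ (by simpa using (mem_ball_zero_iff.1 hz).le)]

/-- The Schur step: Schwarz-Pick in divisibility form. -/
theorem exists_schurStep {h : ℂ → ℂ} (hh : h ∈ Schur) {z₀ : ℂ} (hz₀ : ‖z₀‖ < 1)
    (h0 : ‖h z₀‖ < 1) :
    ∃ k ∈ Schur, ∀ z ∈ ball (0 : ℂ) 1, h z = T (h z₀) (T (-z₀) z * k z) := by
  obtain ⟨k, hk, hhk⟩ := exists_eq_T_neg_mul
    (T_comp_mem_Schur hh (a := -h z₀) (by simpa using h0)) hz₀ (T_neg_self _)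
  exact ⟨k, hk, fun z hz ↦ by rw [← hhk z hz, T_T_neg h0 (hh.2 z hz)]⟩

theorem eq_const_of_norm_eq_one {h : ℂ → ℂ} (hh : h ∈ Schur) {z₀ : ℂ} (hz₀ : ‖z₀‖ < 1)
    (h0 : ‖h z₀‖ = 1) : ∀ z ∈ ball (0 : ℂ) 1, h z = h z₀ :=
  Complex.eqOn_of_isPreconnected_of_isMaxOn_norm (convex_ball 0 1).isPreconnected isOpen_ball hh.1
    (by simpa using hz₀) fun z hz ↦ by simpa [h0] using hh.2 z hz

theorem analyticAt_of_mem_Schur {h : ℂ → ℂ} (hh : h ∈ Schur) {z : ℂ} (hz : ‖z‖ < 1) :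
    AnalyticAt ℂ h z :=
  hh.1.analyticAt (isOpen_ball.mem_nhds (by simpa using hz))

/-! ### Derivatives at `z₀` up to order three -/

/-- In the Leibniz sum only the term with exactly one derivative on `z - z₀` survives at `z₀`. -/
theorem iteratedDeriv_succ_sub_mul_self {h : ℂ → ℂ} {z₀ : ℂ} (hh : AnalyticAt ℂ h z₀) (n : ℕ) :
    iteratedDeriv (n + 1) (fun z ↦ (z - z₀) * h z) z₀ = (n + 1) * iteratedDeriv n h z₀ := by
  have h2 : ∀ i, iteratedDeriv (i + 2) (fun z : ℂ ↦ z - z₀) z₀ = 0 := fun i ↦ by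
    rw [iteratedDeriv_succ', iteratedDeriv_succ']
    simp
  rw [iteratedDeriv_fun_mul (by fun_prop) hh.contDiffAt, Finset.sum_range_succ',
    Finset.sum_range_succ']
  simp [h2]

theorem iteratedDeriv_const_mul_sub {h : ℂ → ℂ} {z₀ : ℂ} (hh : AnalyticAt ℂ h z₀) (b d : ℂ)
    (n : ℕ) : iteratedDeriv (n + 1) (fun z ↦ b * h z - d) z₀ = b * iteratedDeriv (n + 1) h z₀ := by
  have hc : ContDiffAt ℂ (n + 1 : ℕ) h z₀ := hh.contDiffAt
  rw [iteratedDeriv_fun_sub (by fun_prop) (by fun_prop), iteratedDeriv_const_mul_field]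
  simp [iteratedDeriv_const]

/-- The derivatives at `z₀` of `a P + b (z - z₀) h` with `P = 1 - Z z`. -/
theorem iteratedDeriv_affine_comb {h : ℂ → ℂ} {z₀ : ℂ} (hh : AnalyticAt ℂ h z₀) (a b Z : ℂ)
    {F : ℂ → ℂ} (hF : F = fun z ↦ a * (1 - Z * z) + b * ((z - z₀) * h z)) :
    AnalyticAt ℂ F z₀ ∧ F z₀ = a * (1 - Z * z₀) ∧
    iteratedDeriv 1 F z₀ = b * h z₀ - a * Z ∧
    iteratedDeriv 2 F z₀ = 2 * (b * iteratedDeriv 1 h z₀) ∧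
    iteratedDeriv 3 F z₀ = 3 * (b * iteratedDeriv 2 h z₀) := by
  have key : ∀ n, iteratedDeriv (n + 1) F z₀ =
      (n + 1) * iteratedDeriv n (fun z ↦ b * h z - a * Z) z₀ := fun n ↦ by
    -- Expanding `1 - Z z` around `z₀` leaves a constant plus a multiple of `z - z₀`.
    have hF' : F = fun z ↦ a * (1 - Z * z₀) + (z - z₀) * (b * h z - a * Z) := by
      rw [hF]; funext z; ring
    have hc : AnalyticAt ℂ (fun z ↦ b * h z - a * Z) z₀ := by fun_prop
    have hc' : ContDiffAt ℂ (n + 1 : ℕ) (fun z ↦ (z - z₀) * (b * h z - a * Z)) z₀ :=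
      (by fun_prop : AnalyticAt ℂ (fun z ↦ (z - z₀) * (b * h z - a * Z)) z₀).contDiffAt
    rw [hF', iteratedDeriv_fun_add (by fun_prop) hc', iteratedDeriv_succ_sub_mul_self hc]
    simp [iteratedDeriv_const]
  refine ⟨by rw [hF]; fun_prop, by simp [hF], ?_, ?_, ?_⟩
  · rw [key 0]; simp
  · rw [key 1, iteratedDeriv_const_mul_sub hh]; norm_num
  · rw [key 2, iteratedDeriv_const_mul_sub hh]; norm_num

theorem leibniz_three {f g : ℂ → ℂ} {z₀ : ℂ} (hf : AnalyticAt ℂ f z₀) (hg : AnalyticAt ℂ g z₀) :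
    iteratedDeriv 1 (fun z ↦ f z * g z) z₀ =
      iteratedDeriv 1 f z₀ * g z₀ + f z₀ * iteratedDeriv 1 g z₀ ∧
    iteratedDeriv 2 (fun z ↦ f z * g z) z₀ =
      iteratedDeriv 2 f z₀ * g z₀ + 2 * iteratedDeriv 1 f z₀ * iteratedDeriv 1 g z₀ +
        f z₀ * iteratedDeriv 2 g z₀ ∧
    iteratedDeriv 3 (fun z ↦ f z * g z) z₀ =
      iteratedDeriv 3 f z₀ * g z₀ + 3 * iteratedDeriv 2 f z₀ * iteratedDeriv 1 g z₀ +
        3 * iteratedDeriv 1 f z₀ * iteratedDeriv 2 g z₀ + f z₀ * iteratedDeriv 3 g z₀ := by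
  refine ⟨?_, ?_, ?_⟩ <;> rw [iteratedDeriv_fun_mul hf.contDiffAt hg.contDiffAt] <;>
    simp only [Finset.sum_range_succ, Finset.sum_range_zero, iteratedDeriv_zero]
  · norm_num; ring
  · norm_num; ring
  · norm_num [Nat.choose]; ring

/-- With both denominators cleared, the Leibniz rule replaces repeated quotient rules. The factors
`1 *` keep both combinations in the shape required by `iteratedDeriv_affine_comb`. -/
theorem schurStep_equation {u z₀ z w : ℂ} (hu : ‖u‖ < 1) (hz₀ : ‖z₀‖ < 1) (hz : ‖z‖ < 1)
    (hw : ‖w‖ ≤ 1) :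
    T u (T (-z₀) z * w) * (1 * (1 - conj z₀ * z) + conj u * ((z - z₀) * w)) =
      u * (1 - conj z₀ * z) + 1 * ((z - z₀) * w) := by
  have h1 : 1 - conj z₀ * z ≠ 0 := by
    simpa [sub_eq_add_neg] using
      one_add_conj_mul_ne_zero (a := -z₀) (by simpa using hz₀) hz.le
  have h3 : T (-z₀) z * (1 - conj z₀ * z) = z - z₀ := by
    rw [show T (-z₀) z = (z - z₀) / (1 - conj z₀ * z) by simp [T, sub_eq_add_neg],
      div_mul_cancel₀ _ h1]
  have h2 : 1 + conj u * (T (-z₀) z * w) ≠ 0 := by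
    refine one_add_conj_mul_ne_zero hu ?_
    rw [norm_mul]
    exact mul_le_one₀ (norm_T_le_one (by simpa using hz₀) hz.le) (norm_nonneg _) hw
  have h4 : 1 * (1 - conj z₀ * z) + conj u * ((z - z₀) * w) =
      (1 + conj u * (T (-z₀) z * w)) * (1 - conj z₀ * z) := by
    linear_combination -conj u * w * h3
  rw [h4, T, ← mul_assoc, div_mul_cancel₀ _ h2]
  linear_combination w * h3

/-- The derivatives at `z₀` of `g = T u (T (-z₀) * h)`, given implicitly. -/
theorem schurStep_iteratedDeriv {g h : ℂ → ℂ} (hh : h ∈ Schur) {u z₀ : ℂ} (hu : ‖u‖ < 1)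
    (hz₀ : ‖z₀‖ < 1) (hg : ∀ z ∈ ball (0 : ℂ) 1, g z = T u (T (-z₀) z * h z)) :
    g z₀ = u ∧
    iteratedDeriv 1 g z₀ * (1 - conj z₀ * z₀) + u * (conj u * h z₀ - conj z₀) =
      h z₀ - u * conj z₀ ∧
    iteratedDeriv 2 g z₀ * (1 - conj z₀ * z₀) +
      2 * iteratedDeriv 1 g z₀ * (conj u * h z₀ - conj z₀) +
      u * (2 * (conj u * iteratedDeriv 1 h z₀)) = 2 * iteratedDeriv 1 h z₀ ∧
    iteratedDeriv 3 g z₀ * (1 - conj z₀ * z₀) +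
      3 * iteratedDeriv 2 g z₀ * (conj u * h z₀ - conj z₀) +
      3 * iteratedDeriv 1 g z₀ * (2 * (conj u * iteratedDeriv 1 h z₀)) +
      u * (3 * (conj u * iteratedDeriv 2 h z₀)) = 3 * iteratedDeriv 2 h z₀ := by
  have hg0 : g z₀ = u := by
    rw [hg z₀ (by simpa using hz₀), T_neg_self, zero_mul, T_zero_right]
  have hga : AnalyticAt ℂ g z₀ := by
    have := analyticAt_of_mem_Schur (schurStep_mem_Schur hh hz₀ hu) hz₀
    refine this.congr ?_
    filter_upwards [isOpen_ball.mem_nhds (mem_ball_zero_iff.2 hz₀)] with z hz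
    exact (hg z hz).symm
  have hha := analyticAt_of_mem_Schur hh hz₀
  obtain ⟨hQ, Q0, Q1, Q2, Q3⟩ := iteratedDeriv_affine_comb hha 1 (conj u) (conj z₀) rfl
  obtain ⟨-, -, R1, R2, R3⟩ := iteratedDeriv_affine_comb hha u 1 (conj z₀) rfl
  obtain ⟨L1, L2, L3⟩ := leibniz_three hga hQ
  have heq : (fun z ↦ g z * (1 * (1 - conj z₀ * z) + conj u * ((z - z₀) * h z)))
      =ᶠ[nhds z₀] fun z ↦ u * (1 - conj z₀ * z) + 1 * ((z - z₀) * h z) := by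
    filter_upwards [isOpen_ball.mem_nhds (mem_ball_zero_iff.2 hz₀)] with z hz
    rw [hg z hz, schurStep_equation hu hz₀ (by simpa using hz) (hh.2 z hz)]
  have E1 := heq.iteratedDeriv_eq 1
  have E2 := heq.iteratedDeriv_eq 2
  have E3 := heq.iteratedDeriv_eq 3
  rw [L1, R1, Q1, Q0, hg0] at E1
  rw [L2, R2, Q1, Q2, Q0, hg0] at E2
  rw [L3, R3, Q1, Q2, Q3, Q0, hg0] at E3
  refine ⟨hg0, ?_, ?_, ?_⟩
  · linear_combination E1
  · linear_combination E2
  · linear_combination E3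

/-- The derivatives at `z₀` of `f = z g`. -/
theorem id_mul_iteratedDeriv {f g : ℂ → ℂ} (hga : g ∈ Schur) {z₀ : ℂ} (hz₀ : ‖z₀‖ < 1)
    (hf : ∀ z ∈ ball (0 : ℂ) 1, f z = z * g z) :
    f z₀ = z₀ * g z₀ ∧ deriv f z₀ = g z₀ + z₀ * iteratedDeriv 1 g z₀ ∧
    iteratedDeriv 2 f z₀ = 2 * iteratedDeriv 1 g z₀ + z₀ * iteratedDeriv 2 g z₀ ∧
    iteratedDeriv 3 f z₀ = 3 * iteratedDeriv 2 g z₀ + z₀ * iteratedDeriv 3 g z₀ := by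
  have heq : f =ᶠ[nhds z₀] fun z ↦ z * g z := by
    filter_upwards [isOpen_ball.mem_nhds (mem_ball_zero_iff.2 hz₀)] with z hz using hf z hz
  obtain ⟨L1, L2, L3⟩ := leibniz_three (f := fun z ↦ z) analyticAt_id (analyticAt_of_mem_Schur hga hz₀)
  have h1 : iteratedDeriv 1 (fun z : ℂ ↦ z) z₀ = 1 := by simp
  have h2 : ∀ i, iteratedDeriv (i + 2) (fun z : ℂ ↦ z) z₀ = 0 := fun i ↦ by
    rw [iteratedDeriv_succ', iteratedDeriv_succ']
    simp
  rw [← iteratedDeriv_one, heq.iteratedDeriv_eq, heq.iteratedDeriv_eq, heq.iteratedDeriv_eq,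
    L1, L2, L3, h1, h2 0, h2 1]
  refine ⟨hf z₀ (by simpa using hz₀), ?_, ?_, ?_⟩ <;> ring

/-! ### Rational identities behind `w₁`, `w₂` and `c` -/

section Algebra

variable {z Z w W L La m h0 h1 h2 g1 g2 g3 : ℂ}

/-- `Z`, `W`, `La` stand for the conjugates of `z₀`, `w₀`, `lam`. They may be treated as independent
variables, so the identities are purely rational. The defect from the prescribed derivative factors
through the defect of the Schur parameter. -/
theorem first_order_algebra (hz : z ≠ 0) (hZ : Z ≠ 0) (hq : 1 - z * Z ≠ 0)
    (e1 : g1 * (1 - z * Z) + w / z * (W / Z * h0 - Z) = h0 - w / z * Z) :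
    w / z + z * g1 - (w / z + (z * Z - w * W) / (z * (1 - z * Z)) * L) =
      (z * Z - w * W) / (Z * (1 - z * Z)) * (h0 - Z * L / z) := by
  have hg1 : g1 = h0 * (1 - w / z * (W / Z)) / (1 - z * Z) := by
    rw [eq_div_iff hq]; linear_combination e1
  rw [hg1]
  field_simp
  ring

theorem second_order_algebra (hz : z ≠ 0) (hZ : Z ≠ 0) (hq : 1 - z * Z ≠ 0)
    (h0_eq : h0 = Z * L / z)
    (e1 : g1 * (1 - z * Z) + w / z * (W / Z * h0 - Z) = h0 - w / z * Z)
    (e2 : g2 * (1 - z * Z) + 2 * g1 * (W / Z * h0 - Z) + w / z * (2 * (W / Z * h1)) = 2 * h1) :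
    2 * g1 + z * g2 - (2 * (z * Z - w * W) * L * (1 - W * L) / (z ^ 2 * (1 - z * Z) ^ 2) +
        2 * (z * Z - w * W) * (1 - L * La) / (z * (1 - z * Z) ^ 2) * m) =
      2 * (z * Z - w * W) / (Z * (1 - z * Z) ^ 2) *
        (h1 * (1 - z * Z) - (1 - L * La) * (Z * m / z)) := by
  have hg1 : g1 = h0 * (1 - w / z * (W / Z)) / (1 - z * Z) := by
    rw [eq_div_iff hq]; linear_combination e1
  have hg2 : g2 = (2 * h1 * (1 - w / z * (W / Z)) - 2 * g1 * (W / Z * h0 - Z)) / (1 - z * Z) := by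
    rw [eq_div_iff hq]; linear_combination e2
  have hq' : 1 - Z * z ≠ 0 := by rwa [mul_comm]
  rw [hg2, hg1, h0_eq]
  field_simp
  ring

/-- The last bracket is the left side of the second-order relation for `h = T v (T (-z₀) k)`, so it
later collapses to a multiple of `k'(z₀)`. -/
theorem third_order_algebra (hz : z ≠ 0) (hZ : Z ≠ 0) (hq : 1 - z * Z ≠ 0)
    (h0_eq : h0 = Z * L / z) (h1_eq : h1 * (1 - z * Z) = (1 - L * La) * (Z * m / z))
    (e1 : g1 * (1 - z * Z) + w / z * (W / Z * h0 - Z) = h0 - w / z * Z)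
    (e2 : g2 * (1 - z * Z) + 2 * g1 * (W / Z * h0 - Z) + w / z * (2 * (W / Z * h1)) = 2 * h1)
    (e3 : g3 * (1 - z * Z) + 3 * g2 * (W / Z * h0 - Z) + 3 * g1 * (2 * (W / Z * h1)) +
      w / z * (3 * (W / Z * h2)) = 3 * h2) :
    3 * g2 + z * g3 = 6 * (z * Z - w * W) / (z ^ 3 * (1 - z * Z) ^ 3) *
        (W ^ 2 * L ^ 3 - W * (1 + z * Z) * L ^ 2 + z * Z * L + z * m * (1 - L * La) *
          (1 + z * Z - 2 * W * L - z * La * m)) +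
      3 * (z * Z - w * W) / (Z * (1 - z * Z) ^ 2) *
        (h2 * (1 - z * Z) + 2 * h1 * (z * La / Z * (Z * m / z) - Z)) := by
  have hg1 : g1 = h0 * (1 - w / z * (W / Z)) / (1 - z * Z) := by
    rw [eq_div_iff hq]; linear_combination e1
  have hg2 : g2 = (2 * h1 * (1 - w / z * (W / Z)) - 2 * g1 * (W / Z * h0 - Z)) / (1 - z * Z) := by
    rw [eq_div_iff hq]; linear_combination e2
  have hg3 : g3 = (3 * h2 * (1 - w / z * (W / Z)) - 3 * g2 * (W / Z * h0 - Z) -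
      6 * g1 * (W / Z) * h1) / (1 - z * Z) := by
    rw [eq_div_iff hq]; linear_combination e3
  have hh1 : h1 = (1 - L * La) * (Z * m / z) / (1 - z * Z) := by rw [eq_div_iff hq, h1_eq]
  have hq' : 1 - Z * z ≠ 0 := by rwa [mul_comm]
  rw [hg3, hg2, hg1, hh1, h0_eq]
  field_simp
  ring

end Algebra

/-! ### Prescribed data as Schur parameters -/

theorem one_sub_self_mul_conj_ne_zero {z : ℂ} (hz : ‖z‖ < 1) : 1 - z * conj z ≠ 0 := by
  have := one_add_conj_mul_ne_zero (a := -z) (by simpa using hz) hz.le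
  rwa [map_neg, neg_mul, ← sub_eq_add_neg, mul_comm] at this

theorem self_mul_conj_sub_ne_zero {z w : ℂ} (hw : ‖w‖ < ‖z‖) :
    z * conj z - w * conj w ≠ 0 := by
  rw [Complex.mul_conj', Complex.mul_conj', sub_ne_zero]
  intro h
  have h' : ‖z‖ ^ 2 = ‖w‖ ^ 2 := by exact_mod_cast h
  nlinarith [norm_nonneg w]

theorem v0_eq {z₀ : ℂ} (hz : z₀ ≠ 0) (lam : ℂ) : v0 z₀ lam = conj z₀ * lam / z₀ := by
  rw [v0, ← Complex.mul_conj']; field_simp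

theorem eta_eq_v0 (z₀ mu : ℂ) : eta z₀ mu = v0 z₀ mu := rfl

theorem tau_eq_v0 {z₀ : ℂ} (hz : z₀ ≠ 0) (mu : ℂ) : tau z₀ mu = v0 z₀ mu := (v0_eq hz mu).symm

/-- This turns the case distinction on `lam` and `mu` into one on Schur parameters, since `tau` and
`eta` are both `v0` evaluated at `mu`. -/
theorem norm_v0 {z₀ : ℂ} (hz : z₀ ≠ 0) (lam : ℂ) : ‖v0 z₀ lam‖ = ‖lam‖ := by
  have := norm_ne_zero_iff.2 hz
  simp [v0]; field_simp

theorem conj_v0 {z₀ : ℂ} (hz : z₀ ≠ 0) (lam : ℂ) :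
    conj (v0 z₀ lam) = z₀ * conj lam / conj z₀ := by
  rw [v0_eq hz]; simp

theorem norm_u0_lt_one {z₀ w₀ : ℂ} (hw₀ : ‖w₀‖ < ‖z₀‖) : ‖u0 z₀ w₀‖ < 1 := by
  rw [u0, norm_div, div_lt_one ((norm_nonneg _).trans_lt hw₀)]
  exact hw₀

/-- Derivatives at `z₀` of `f = z T u₀ (T (-z₀) h)` compared with the prescribed data. -/
theorem iteratedDeriv_of_first_factor {f h : ℂ → ℂ} {z₀ w₀ : ℂ} (lam mu : ℂ) (hz₀ : ‖z₀‖ < 1)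
    (hw₀ : ‖w₀‖ < ‖z₀‖) (hh : h ∈ Schur)
    (hf : ∀ z ∈ ball (0 : ℂ) 1, f z = z * T (u0 z₀ w₀) (T (-z₀) z * h z)) :
    f z₀ = w₀ ∧ (deriv f z₀ = w1 z₀ w₀ lam ↔ h z₀ = v0 z₀ lam) ∧
    (h z₀ = v0 z₀ lam → (iteratedDeriv 2 f z₀ = w2 z₀ w₀ lam mu ↔
      iteratedDeriv 1 h z₀ * (1 - z₀ * conj z₀) = (1 - lam * conj lam) * v0 z₀ mu) ∧
      (iteratedDeriv 1 h z₀ * (1 - z₀ * conj z₀) = (1 - lam * conj lam) * v0 z₀ mu →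
        iteratedDeriv 3 f z₀ = c z₀ w₀ lam mu + 3 * (z₀ * conj z₀ - w₀ * conj w₀) /
          (conj z₀ * (1 - z₀ * conj z₀) ^ 2) * (iteratedDeriv 2 h z₀ * (1 - z₀ * conj z₀) +
            2 * iteratedDeriv 1 h z₀ * (conj (v0 z₀ lam) * v0 z₀ mu - conj z₀)))) := by
  have hz : z₀ ≠ 0 := norm_pos_iff.1 ((norm_nonneg _).trans_lt hw₀)
  have hZ : conj z₀ ≠ 0 := by simpa using hz
  have hq := one_sub_self_mul_conj_ne_zero hz₀
  have hzw := self_mul_conj_sub_ne_zero hw₀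
  have hu := norm_u0_lt_one hw₀
  obtain ⟨f0, f1, f2, f3⟩ := id_mul_iteratedDeriv (schurStep_mem_Schur hh hz₀ hu) hz₀ hf
  obtain ⟨g0, e1, e2, e3⟩ := schurStep_iteratedDeriv hh hu hz₀ fun z _ ↦ rfl
  have hU : conj (u0 z₀ w₀) = conj w₀ / conj z₀ := by simp [u0]
  rw [g0] at f0 f1
  rw [hU, mul_comm (conj z₀) z₀] at e1 e2 e3
  simp only [u0] at f0 f1 f2 f3 e1 e2 e3
  refine ⟨by rw [f0, mul_div_cancel₀ _ hz], ?_, fun h0 ↦ ⟨?_, fun h1 ↦ ?_⟩⟩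
  -- The prefactor is nonzero because `|w₀| < |z₀| < 1`, so the two defects vanish together.
  · rw [← sub_eq_zero, f1, w1, ← Complex.mul_conj', ← Complex.mul_conj',
      first_order_algebra hz hZ hq e1, v0_eq hz, mul_eq_zero, sub_eq_zero, or_iff_right]
    exact div_ne_zero hzw (mul_ne_zero hZ hq)
  · rw [v0_eq hz] at h0
    rw [← sub_eq_zero, f2, w2, ← Complex.mul_conj', ← Complex.mul_conj', ← Complex.mul_conj',
      second_order_algebra hz hZ hq h0 e1 e2, v0_eq hz, mul_eq_zero, sub_eq_zero, or_iff_right]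
    exact div_ne_zero (mul_ne_zero two_ne_zero hzw) (mul_ne_zero hZ (pow_ne_zero 2 hq))
  · rw [v0_eq hz] at h0 h1
    rw [f3, c, B, ← Complex.mul_conj', ← Complex.mul_conj', ← Complex.mul_conj', conj_v0 hz,
      v0_eq hz, third_order_algebra hz hZ hq h0 h1 e1 e2 e3]

/-- Derivatives at `z₀` of `h = T v (T (-z₀) k)`. -/
theorem iteratedDeriv_of_second_factor {h k : ℂ → ℂ} {z₀ v : ℂ} (hz₀ : ‖z₀‖ < 1)
    (hv : ‖v‖ < 1) (hk : k ∈ Schur)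
    (hh : ∀ z ∈ ball (0 : ℂ) 1, h z = T v (T (-z₀) z * k z)) :
    h z₀ = v ∧ iteratedDeriv 1 h z₀ * (1 - z₀ * conj z₀) = (1 - v * conj v) * k z₀ ∧
    iteratedDeriv 2 h z₀ * (1 - z₀ * conj z₀) +
      2 * iteratedDeriv 1 h z₀ * (conj v * k z₀ - conj z₀) =
        2 * (1 - v * conj v) * iteratedDeriv 1 k z₀ := by
  obtain ⟨h0, e1, e2, -⟩ := schurStep_iteratedDeriv hk hv hz₀ hh
  exact ⟨h0, by linear_combination e1, by linear_combination e2⟩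

theorem v0_mul_conj_v0 {z₀ : ℂ} (hz : z₀ ≠ 0) (lam : ℂ) :
    v0 z₀ lam * conj (v0 z₀ lam) = lam * conj lam := by
  rw [Complex.mul_conj', norm_v0 hz, Complex.mul_conj']

theorem one_sub_mul_conj_ne_zero {lam : ℂ} (h : ‖lam‖ < 1) : 1 - lam * conj lam ≠ 0 :=
  one_sub_self_mul_conj_ne_zero h

/-- Derivatives at `z₀` of `f = z T u₀ (T (-z₀) T v₀ (T (-z₀) k))` compared with the
prescribed data. -/
theorem iteratedDeriv_of_two_factors {f k : ℂ → ℂ} {z₀ w₀ lam : ℂ} (mu : ℂ) (hz₀ : ‖z₀‖ < 1)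
    (hw₀ : ‖w₀‖ < ‖z₀‖) (hlam : ‖lam‖ < 1) (hk : k ∈ Schur)
    (hf : ∀ z ∈ ball (0 : ℂ) 1,
      f z = z * T (u0 z₀ w₀) (T (-z₀) z * T (v0 z₀ lam) (T (-z₀) z * k z))) :
    f z₀ = w₀ ∧ deriv f z₀ = w1 z₀ w₀ lam ∧
    (iteratedDeriv 2 f z₀ = w2 z₀ w₀ lam mu ↔ k z₀ = v0 z₀ mu) ∧
    (k z₀ = v0 z₀ mu → iteratedDeriv 3 f z₀ = c z₀ w₀ lam mu +
      6 * (z₀ * conj z₀ - w₀ * conj w₀) / (conj z₀ * (1 - z₀ * conj z₀) ^ 2) *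
        (1 - lam * conj lam) * iteratedDeriv 1 k z₀) := by
  have hz : z₀ ≠ 0 := norm_pos_iff.1 ((norm_nonneg _).trans_lt hw₀)
  have hv : ‖v0 z₀ lam‖ < 1 := by rwa [norm_v0 hz]
  obtain ⟨h0, e1, e2⟩ := iteratedDeriv_of_second_factor hz₀ hv hk fun z _ ↦ rfl
  obtain ⟨f0, f1, f23⟩ := iteratedDeriv_of_first_factor lam mu hz₀ hw₀
    (schurStep_mem_Schur hk hz₀ hv) hf
  obtain ⟨f2, f3⟩ := f23 h0
  rw [v0_mul_conj_v0 hz] at e1 e2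
  refine ⟨f0, f1.2 h0, ?_, fun hk0 ↦ ?_⟩
  · rw [f2, e1, mul_right_inj' (one_sub_mul_conj_ne_zero hlam)]
  · rw [f3 (by rw [e1, hk0]), ← hk0, e2]
    ring

/-! ### Synthesis: every last Schur function gives an admissible map -/

/-- The coefficient of `l z₀` in `f'''(z₀)`, a unimodular multiple of `rho`. -/
noncomputable def rhoCoeff (z₀ w₀ lam mu : ℂ) : ℂ :=
  6 * (z₀ * conj z₀ - w₀ * conj w₀) / (conj z₀ * (1 - z₀ * conj z₀) ^ 3) *
    (1 - lam * conj lam) * (1 - mu * conj mu)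

theorem norm_rhoCoeff {z₀ w₀ lam mu : ℂ} (hz₀ : ‖z₀‖ < 1) (hw₀ : ‖w₀‖ < ‖z₀‖)
    (hlam : ‖lam‖ < 1) (hmu : ‖mu‖ < 1) : ‖rhoCoeff z₀ w₀ lam mu‖ = rho z₀ w₀ lam mu := by
  have key : ∀ a b : ℝ, 0 ≤ a → a ≤ b → ‖((b : ℂ) ^ 2 - (a : ℂ) ^ 2)‖ = b ^ 2 - a ^ 2 :=
    fun a b ha hab ↦ by
      rw [← Complex.ofReal_pow, ← Complex.ofReal_pow, ← Complex.ofReal_sub, Complex.norm_real,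
        Real.norm_of_nonneg (by nlinarith)]
  have key1 : ∀ a : ℂ, ‖a‖ < 1 → ‖1 - (‖a‖ : ℂ) ^ 2‖ = 1 - ‖a‖ ^ 2 := fun a ha ↦ by
    simpa using key ‖a‖ 1 (norm_nonneg _) ha.le
  rw [rhoCoeff, rho]
  simp only [Complex.mul_conj', norm_mul, norm_div, norm_pow, RCLike.norm_conj]
  rw [key _ _ (norm_nonneg _) hw₀.le, key1 _ hz₀, key1 _ hlam, key1 _ hmu]
  norm_num

theorem rho_pos {z₀ w₀ lam mu : ℂ} (hz₀ : ‖z₀‖ < 1) (hw₀ : ‖w₀‖ < ‖z₀‖)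
    (hlam : ‖lam‖ < 1) (hmu : ‖mu‖ < 1) : 0 < rho z₀ w₀ lam mu := by
  have key : ∀ a b : ℝ, 0 ≤ a → a < b → 0 < b ^ 2 - a ^ 2 := fun a b _ _ ↦ by nlinarith
  have key1 : ∀ a : ℂ, ‖a‖ < 1 → 0 < 1 - ‖a‖ ^ 2 := fun a ha ↦ by
    simpa using key ‖a‖ 1 (norm_nonneg _) ha
  have := key _ _ (norm_nonneg _) hw₀
  have := key1 _ hz₀
  have := key1 _ hlam
  have := key1 _ hmu
  have := (norm_nonneg _).trans_lt hw₀
  rw [rho]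
  positivity

theorem mem_H0_of_eq_schurStep {f h : ℂ → ℂ} {z₀ u : ℂ} (hz₀ : ‖z₀‖ < 1) (hu : ‖u‖ < 1)
    (hh : h ∈ Schur) (hf : ∀ z ∈ ball (0 : ℂ) 1, f z = z * T u (T (-z₀) z * h z)) :
    f ∈ H0 := by
  refine ⟨?_, fun z hz ↦ ?_, ?_⟩
  · exact (differentiableOn_id.mul (schurStep_mem_Schur hh hz₀ hu).1).congr hf
  · have hz' : ‖z‖ < 1 := by simpa using hz
    have := norm_schurStep_lt_one hh hz₀ hu hz'
    rw [mem_ball_zero_iff, hf z hz, norm_mul]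
    nlinarith [norm_nonneg z, norm_nonneg (T u (T (-z₀) z * h z))]
  · rw [hf 0 (by simp), zero_mul]

/-- The function with Schur parameters `u₀, v₀, η` and last Schur function `l`. -/
theorem mem_admissible_of_three_factors {f l : ℂ → ℂ} {z₀ w₀ lam mu : ℂ} (hz₀ : ‖z₀‖ < 1)
    (hw₀ : ‖w₀‖ < ‖z₀‖) (hlam : ‖lam‖ < 1) (hmu : ‖mu‖ < 1) (hl : l ∈ Schur)
    (hf : ∀ z ∈ ball (0 : ℂ) 1, f z = z * T (u0 z₀ w₀) (T (-z₀) z * T (v0 z₀ lam)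
      (T (-z₀) z * T (eta z₀ mu) (T (-z₀) z * l z)))) :
    f ∈ admissible z₀ w₀ lam mu ∧
      iteratedDeriv 3 f z₀ = c z₀ w₀ lam mu + rhoCoeff z₀ w₀ lam mu * l z₀ := by
  have hz : z₀ ≠ 0 := norm_pos_iff.1 ((norm_nonneg _).trans_lt hw₀)
  have hv : ‖v0 z₀ lam‖ < 1 := by rwa [norm_v0 hz]
  have he : ‖eta z₀ mu‖ < 1 := by rwa [eta_eq_v0, norm_v0 hz]
  have hk := schurStep_mem_Schur hl hz₀ he
  obtain ⟨k0, e1, -⟩ := iteratedDeriv_of_second_factor hz₀ he hl fun z _ ↦ rfl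
  obtain ⟨f0, f1, f2, f3⟩ := iteratedDeriv_of_two_factors mu hz₀ hw₀ hlam hk hf
  refine ⟨⟨mem_H0_of_eq_schurStep hz₀ (norm_u0_lt_one hw₀)
    (schurStep_mem_Schur hk hz₀ hv) hf, f0, f1, f2.2 k0⟩, ?_⟩
  have hq := one_sub_self_mul_conj_ne_zero hz₀
  rw [eta_eq_v0, v0_mul_conj_v0 hz, ← eq_div_iff hq] at e1
  rw [f3 k0, eta_eq_v0, e1, rhoCoeff]
  have hZ : conj z₀ ≠ 0 := by simpa using hz
  field_simp

/-! ### Analysis: peeling Schur parameters off an admissible map -/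

theorem exists_first_factor {f : ℂ → ℂ} {z₀ w₀ lam mu : ℂ} (hz₀ : ‖z₀‖ < 1)
    (hw₀ : ‖w₀‖ < ‖z₀‖) (hf : f ∈ admissible z₀ w₀ lam mu) :
    ∃ h ∈ Schur, h z₀ = v0 z₀ lam ∧
      ∀ z ∈ ball (0 : ℂ) 1, f z = z * T (u0 z₀ w₀) (T (-z₀) z * h z) := by
  have hz : z₀ ≠ 0 := norm_pos_iff.1 ((norm_nonneg _).trans_lt hw₀)
  obtain ⟨⟨hd, hm, hf0⟩, f0, f1, -⟩ := hf
  obtain ⟨g, hg, hfg⟩ := exists_eq_id_mul (F := f)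
    ⟨hd, fun z hz ↦ (mem_ball_zero_iff.1 (hm hz)).le⟩ hf0
  have hg0 : g z₀ = u0 z₀ w₀ := by
    rw [u0, eq_div_iff hz, ← f0, hfg z₀, mul_comm]
  obtain ⟨h, hh, hgh⟩ := exists_schurStep hg hz₀ (by rw [hg0]; exact norm_u0_lt_one hw₀)
  have hfh : ∀ z ∈ ball (0 : ℂ) 1, f z = z * T (u0 z₀ w₀) (T (-z₀) z * h z) := fun z hz ↦ by
    rw [hfg, hgh z hz, hg0]
  exact ⟨h, hh, (iteratedDeriv_of_first_factor lam mu hz₀ hw₀ hh hfh).2.1.1 f1, hfh⟩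

theorem exists_two_factors {f : ℂ → ℂ} {z₀ w₀ lam mu : ℂ} (hz₀ : ‖z₀‖ < 1)
    (hw₀ : ‖w₀‖ < ‖z₀‖) (hlam : ‖lam‖ < 1) (hf : f ∈ admissible z₀ w₀ lam mu) :
    ∃ k ∈ Schur, k z₀ = v0 z₀ mu ∧ ∀ z ∈ ball (0 : ℂ) 1,
      f z = z * T (u0 z₀ w₀) (T (-z₀) z * T (v0 z₀ lam) (T (-z₀) z * k z)) := by
  have hz : z₀ ≠ 0 := norm_pos_iff.1 ((norm_nonneg _).trans_lt hw₀)
  obtain ⟨h, hh, hh0, hfh⟩ := exists_first_factor hz₀ hw₀ hf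
  obtain ⟨k, hk, hhk⟩ := exists_schurStep hh hz₀ (by rwa [hh0, norm_v0 hz])
  have hfk : ∀ z ∈ ball (0 : ℂ) 1,
      f z = z * T (u0 z₀ w₀) (T (-z₀) z * T (v0 z₀ lam) (T (-z₀) z * k z)) := fun z hz ↦ by
    rw [hfh z hz, hhk z hz, hh0]
  exact ⟨k, hk, (iteratedDeriv_of_two_factors mu hz₀ hw₀ hlam hk hfk).2.2.1.1 hf.2.2.2, hfk⟩

theorem exists_three_factors {f : ℂ → ℂ} {z₀ w₀ lam mu : ℂ} (hz₀ : ‖z₀‖ < 1)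
    (hw₀ : ‖w₀‖ < ‖z₀‖) (hlam : ‖lam‖ < 1) (hmu : ‖mu‖ < 1)
    (hf : f ∈ admissible z₀ w₀ lam mu) :
    ∃ l ∈ Schur, ∀ z ∈ ball (0 : ℂ) 1, f z = z * T (u0 z₀ w₀) (T (-z₀) z * T (v0 z₀ lam)
      (T (-z₀) z * T (eta z₀ mu) (T (-z₀) z * l z))) := by
  have hz : z₀ ≠ 0 := norm_pos_iff.1 ((norm_nonneg _).trans_lt hw₀)
  obtain ⟨k, hk, hk0, hfk⟩ := exists_two_factors hz₀ hw₀ hlam hf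
  obtain ⟨l, hl, hkl⟩ := exists_schurStep hk hz₀ (by rwa [hk0, norm_v0 hz])
  exact ⟨l, hl, fun z hz ↦ by rw [hfk z hz, hkl z hz, hk0, eta_eq_v0]⟩

/-! ### Rigid cases, the disk of values and its boundary -/

theorem iteratedDeriv_eq_zero_of_eqOn_const {h : ℂ → ℂ} {z₀ a : ℂ} (hz₀ : ‖z₀‖ < 1)
    (hh : ∀ z ∈ ball (0 : ℂ) 1, h z = a) (n : ℕ) : iteratedDeriv (n + 1) h z₀ = 0 := by
  have : h =ᶠ[nhds z₀] fun _ ↦ a := by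
    filter_upwards [isOpen_ball.mem_nhds (mem_ball_zero_iff.2 hz₀)] with z hz using hh z hz
  rw [this.iteratedDeriv_eq, iteratedDeriv_const]
  simp

theorem rigidity_of_norm_lam_eq_one {f : ℂ → ℂ} {z₀ w₀ lam mu : ℂ} (hz₀ : ‖z₀‖ < 1)
    (hw₀ : ‖w₀‖ < ‖z₀‖) (hlam : ‖lam‖ = 1) (hf : f ∈ admissible z₀ w₀ lam mu) :
    iteratedDeriv 3 f z₀ = c z₀ w₀ lam mu ∧ ∀ z ∈ ball (0 : ℂ) 1,
      f z = z * T (u0 z₀ w₀) (v0 z₀ lam * T (-z₀) z) := by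
  have hz : z₀ ≠ 0 := norm_pos_iff.1 ((norm_nonneg _).trans_lt hw₀)
  obtain ⟨h, hh, hh0, hfh⟩ := exists_first_factor hz₀ hw₀ hf
  have hc := eq_const_of_norm_eq_one hh hz₀ (by rwa [hh0, norm_v0 hz])
  refine ⟨?_, fun z hz ↦ by rw [hfh z hz, hc z hz, hh0, mul_comm (T (-z₀) z)]⟩
  have h1 := iteratedDeriv_eq_zero_of_eqOn_const hz₀ hc 0
  have h2 := iteratedDeriv_eq_zero_of_eqOn_const hz₀ hc 1
  rw [zero_add] at h1
  rw [one_add_one_eq_two] at h2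
  -- The second-order relation reads `0 = 0` here: `h` is constant and `1 - |lam|² = 0`.
  rw [((iteratedDeriv_of_first_factor lam mu hz₀ hw₀ hh hfh).2.2 hh0).2
    (by rw [h1, Complex.mul_conj' lam, hlam]; simp), h1, h2]
  simp

theorem rigidity_of_norm_mu_eq_one {f : ℂ → ℂ} {z₀ w₀ lam mu : ℂ} (hz₀ : ‖z₀‖ < 1)
    (hw₀ : ‖w₀‖ < ‖z₀‖) (hlam : ‖lam‖ < 1) (hmu : ‖mu‖ = 1)
    (hf : f ∈ admissible z₀ w₀ lam mu) :
    iteratedDeriv 3 f z₀ = c z₀ w₀ lam mu ∧ ∀ z ∈ ball (0 : ℂ) 1,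
      f z = z * T (u0 z₀ w₀) (T (-z₀) z * T (v0 z₀ lam) (tau z₀ mu * T (-z₀) z)) := by
  have hz : z₀ ≠ 0 := norm_pos_iff.1 ((norm_nonneg _).trans_lt hw₀)
  obtain ⟨k, hk, hk0, hfk⟩ := exists_two_factors hz₀ hw₀ hlam hf
  have hc := eq_const_of_norm_eq_one hk hz₀ (by rwa [hk0, norm_v0 hz])
  refine ⟨?_, fun z hz' ↦ by
    rw [hfk z hz', hc z hz', hk0, mul_comm (T (-z₀) z) (v0 z₀ mu), tau_eq_v0 hz]⟩
  have h1 := iteratedDeriv_eq_zero_of_eqOn_const hz₀ hc 0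
  rw [zero_add] at h1
  rw [(iteratedDeriv_of_two_factors mu hz₀ hw₀ hlam hk hfk).2.2.2 hk0, h1]
  simp

theorem setOf_iteratedDeriv_three_eq_closedBall {z₀ w₀ lam mu : ℂ} (hz₀ : ‖z₀‖ < 1)
    (hw₀ : ‖w₀‖ < ‖z₀‖) (hlam : ‖lam‖ < 1) (hmu : ‖mu‖ < 1) :
    {ζ : ℂ | ∃ f ∈ admissible z₀ w₀ lam mu, iteratedDeriv 3 f z₀ = ζ} =
      closedBall (c z₀ w₀ lam mu) (rho z₀ w₀ lam mu) := by
  have hr := rho_pos hz₀ hw₀ hlam hmu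
  have hn := norm_rhoCoeff hz₀ hw₀ hlam hmu
  ext ζ
  rw [mem_ofPred_eq, mem_closedBall_iff_norm]
  constructor
  · rintro ⟨f, hf, rfl⟩
    obtain ⟨l, hl, hfl⟩ := exists_three_factors hz₀ hw₀ hlam hmu hf
    rw [(mem_admissible_of_three_factors hz₀ hw₀ hlam hmu hl hfl).2, add_sub_cancel_left,
      norm_mul, hn]
    exact mul_le_of_le_one_right hr.le (hl.2 z₀ (by simpa using hz₀))
  · intro hζ
    have hne : rhoCoeff z₀ w₀ lam mu ≠ 0 := norm_pos_iff.1 (hn ▸ hr)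
    -- A constant last Schur function suffices: solve `c + rhoCoeff * l = ζ` for `l`.
    have hl : (fun _ ↦ (ζ - c z₀ w₀ lam mu) / rhoCoeff z₀ w₀ lam mu) ∈ Schur :=
      const_mem_Schur (by rw [norm_div, hn]; exact div_le_one_of_le₀ hζ hr.le)
    obtain ⟨ha, h3⟩ := mem_admissible_of_three_factors hz₀ hw₀ hlam hmu hl fun z _ ↦ rfl
    refine ⟨_, ha, ?_⟩
    rw [h3, mul_div_cancel₀ _ hne, add_sub_cancel]

theorem mem_sphere_iff_exists_exp {z₀ w₀ lam mu : ℂ} (hz₀ : ‖z₀‖ < 1)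
    (hw₀ : ‖w₀‖ < ‖z₀‖) (hlam : ‖lam‖ < 1) (hmu : ‖mu‖ < 1) (f : ℂ → ℂ) :
    (f ∈ admissible z₀ w₀ lam mu ∧
      iteratedDeriv 3 f z₀ ∈ sphere (c z₀ w₀ lam mu) (rho z₀ w₀ lam mu)) ↔
    ∃ θ : ℝ, ∀ z ∈ ball (0 : ℂ) 1, f z = z * T (u0 z₀ w₀) (T (-z₀) z * T (v0 z₀ lam)
      (T (-z₀) z * T (eta z₀ mu) (Complex.exp (θ * Complex.I) * T (-z₀) z))) := by
  have hr := rho_pos hz₀ hw₀ hlam hmu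
  have hn := norm_rhoCoeff hz₀ hw₀ hlam hmu
  constructor
  · rintro ⟨hf, hs⟩
    obtain ⟨l, hl, hfl⟩ := exists_three_factors hz₀ hw₀ hlam hmu hf
    -- As `rho` is nonzero, lying on the circle means `‖l z₀‖ = 1`, so the maximum principle makes
    -- `l` constant.
    rw [(mem_admissible_of_three_factors hz₀ hw₀ hlam hmu hl hfl).2, mem_sphere_iff_norm,
      add_sub_cancel_left, norm_mul, hn, mul_eq_left₀ hr.ne'] at hs
    obtain ⟨θ, hθ⟩ := (Complex.norm_eq_one_iff _).1 hs
    refine ⟨θ, fun z hz ↦ ?_⟩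
    rw [hfl z hz, eq_const_of_norm_eq_one hl hz₀ hs z hz, hθ, mul_comm (l z₀)]
  · rintro ⟨θ, hf⟩
    have h1 : ‖Complex.exp (θ * Complex.I)‖ = 1 := Complex.norm_exp_ofReal_mul_I θ
    obtain ⟨ha, h3⟩ := mem_admissible_of_three_factors hz₀ hw₀ hlam hmu (f := f)
      (const_mem_Schur h1.le) fun z hz ↦ by
        rw [hf z hz, mul_comm (Complex.exp (θ * Complex.I))]
    refine ⟨ha, ?_⟩
    rw [h3, mem_sphere_iff_norm, add_sub_cancel_left, norm_mul, h1, mul_one, hn]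

end ThirdDieudonne

theorem theorem1p1 (z₀ w₀ lam mu : ℂ) (hz₀ : ‖z₀‖ < 1) (hw₀ : ‖w₀‖ < ‖z₀‖)
    (hlam : ‖lam‖ ≤ 1) (hmu : ‖mu‖ ≤ 1) :
    (‖lam‖ = 1 → ∀ f ∈ ThirdDieudonne.admissible z₀ w₀ lam mu,
      iteratedDeriv 3 f z₀ = ThirdDieudonne.c z₀ w₀ lam mu ∧
      ∀ z ∈ Metric.ball (0 : ℂ) 1,
        f z = z * ThirdDieudonne.T (ThirdDieudonne.u0 z₀ w₀)
          (ThirdDieudonne.v0 z₀ lam * ThirdDieudonne.T (-z₀) z)) ∧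
    (‖lam‖ < 1 → ‖mu‖ = 1 → ∀ f ∈ ThirdDieudonne.admissible z₀ w₀ lam mu,
      iteratedDeriv 3 f z₀ = ThirdDieudonne.c z₀ w₀ lam mu ∧
      ∀ z ∈ Metric.ball (0 : ℂ) 1,
        f z = z * ThirdDieudonne.T (ThirdDieudonne.u0 z₀ w₀)
          (ThirdDieudonne.T (-z₀) z * ThirdDieudonne.T (ThirdDieudonne.v0 z₀ lam)
            (ThirdDieudonne.tau z₀ mu * ThirdDieudonne.T (-z₀) z))) ∧
    (‖lam‖ < 1 → ‖mu‖ < 1 →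
      {ζ : ℂ | ∃ f ∈ ThirdDieudonne.admissible z₀ w₀ lam mu, iteratedDeriv 3 f z₀ = ζ} =
        Metric.closedBall (ThirdDieudonne.c z₀ w₀ lam mu) (ThirdDieudonne.rho z₀ w₀ lam mu) ∧
      ∀ f : ℂ → ℂ,
        (f ∈ ThirdDieudonne.admissible z₀ w₀ lam mu ∧
          iteratedDeriv 3 f z₀ ∈ Metric.sphere (ThirdDieudonne.c z₀ w₀ lam mu)
            (ThirdDieudonne.rho z₀ w₀ lam mu)) ↔
        ∃ θ : ℝ, ∀ z ∈ Metric.ball (0 : ℂ) 1,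
          f z = z * ThirdDieudonne.T (ThirdDieudonne.u0 z₀ w₀)
            (ThirdDieudonne.T (-z₀) z * ThirdDieudonne.T (ThirdDieudonne.v0 z₀ lam)
              (ThirdDieudonne.T (-z₀) z * ThirdDieudonne.T (ThirdDieudonne.eta z₀ mu)
                (Complex.exp (θ * Complex.I) * ThirdDieudonne.T (-z₀) z)))) := by
  exact ⟨fun h f hf ↦ ThirdDieudonne.rigidity_of_norm_lam_eq_one hz₀ hw₀ h hf,
    fun h h' f hf ↦ ThirdDieudonne.rigidity_of_norm_mu_eq_one hz₀ hw₀ h h' hf,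
    fun h h' ↦ ⟨ThirdDieudonne.setOf_iteratedDeriv_three_eq_closedBall hz₀ hw₀ h h',
      ThirdDieudonne.mem_sphere_iff_exists_exp hz₀ hw₀ h h'⟩⟩
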